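/- A bi-infinite path is a subgraph $P=(V(P),E(P))$ of the square lattice $\mathbb{Z}^2$ for which there is a bijection $t:V(P)\to\mathbb{Z}$ such that two vertices are adjacent in $P$ if and only if their $t$-values are consecutive integers. The space of bi-infinite paths carries the $\sigma$-algebra generated by the events $\{P : e\in E(P)\}$, where $e$ ranges over the lattice edges. Suppose that $P$ meets every integer translate of the positive and negative $x$- and $y$-half-axes infinitely many times. For a vertex $p=(a,b)$ of $P$ and $n\ge 1$, let $p_n^{x_+}$ be the $n$-th closest to $p$ among the vertices of $P$ on the half-line $\{(s,b): s>a\}$, and define $p_n^{x_-},p_n^{y_+},p_n^{y_-}$ in the same way for the other three directions. The $n$-th cross of $p$ is the union of the segment from $p_n^{x_-}$ to $p_n^{x_+}$ and the segment from $p_n^{y_-}$ to $p_n^{y_+}$. The $n$-th snail of $p$ is the smallest connected subgraph of $P$ that contains $p$ and all vertices of $P$ lying on the $n$-th cross of $p$; its length is its number of edges. Theorem. Let $\mu$ be a finite measure (for instance a probability measure) on the space of bi-infinite paths in $\mathbb{Z}^2$ that is invariant under all translations by vectors of $\mathbb{Z}^2$. Then for $\mu$-almost every path $P$ the following holds. The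 path $P$ meets every integer translate of the positive and negative $x$- and $y$-half-axes infinitely many times (so that all crosses and snails are defined), and for every vertex $p$ of $P$ there is a constant $c=c(p,P)>0$ such that for infinitely many $n\in\mathbb{N}$ the length of the $n$-th snail of $p$ is at least $cn^2$. -/

import Mathlib

namespace PlanarPath

/-- The standard square lattice graph on `ℤ²`: neighbours are the points at `ℓ¹`-distance one. -/
def lattice : SimpleGraph (ℤ × ℤ) where
  Adj u v := |u.1 - v.1| + |u.2 - v.2| = 1
  symm := ⟨fun u v h => by rw [abs_sub_comm v.1, abs_sub_comm v.2]; exact h⟩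
  loopless := ⟨fun u h => by simp at h⟩

/-- A subgraph of the lattice is a (simple, two-sided infinite) path if it has a direction:
a bijection from its vertices to `ℤ` under which two vertices are adjacent in the path
iff their images are consecutive integers. -/
def IsBiInfinitePath (P : lattice.Subgraph) : Prop :=
  ∃ t : P.verts ≃ ℤ, ∀ u v : P.verts, P.Adj u v ↔ |t u - t v| = 1

/-- The space of bi-infinite simple paths in the square lattice. -/
abbrev BiPath : Type := {P : lattice.Subgraph // IsBiInfinitePath P}

/-- The σ-algebra on the space of paths inherited from the product σ-algebra on `{0,1}^E`:
it is generated by the events "the edge `uv` belongs to the path". -/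
instance : MeasurableSpace BiPath :=
  MeasurableSpace.generateFrom {A | ∃ u v : ℤ × ℤ, A = {P : BiPath | P.1.Adj u v}}

/-- The translate of a subgraph of the lattice by the vector `z`. -/
def shift (z : ℤ × ℤ) (P : lattice.Subgraph) : lattice.Subgraph where
  verts := {u | u - z ∈ P.verts}
  Adj u v := P.Adj (u - z) (v - z)
  adj_sub {u v} h := by
    have := P.adj_sub h
    simpa [lattice] using this
  edge_vert h := P.edge_vert h
  symm := ⟨fun _ _ h => P.adj_symm h⟩

theorem IsBiInfinitePath.shift {P : lattice.Subgraph} (hP : IsBiInfinitePath P) (z : ℤ × ℤ) :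
    IsBiInfinitePath (shift z P) := by
  obtain ⟨t, ht⟩ := hP
  let e : (PlanarPath.shift z P).verts ≃ P.verts :=
    { toFun := fun u => ⟨u.1 - z, u.2⟩
      invFun := fun u => ⟨u.1 + z, by
        change u.1 + z - z ∈ P.verts
        rw [add_sub_cancel_right]; exact u.2⟩
      left_inv := fun u => Subtype.ext (sub_add_cancel _ _)
      right_inv := fun u => Subtype.ext (add_sub_cancel_right _ _) }
  exact ⟨e.trans t, fun u v => ht (e u) (e v)⟩

/-- Translation by `z`, acting on the space of paths. -/
def translate (z : ℤ × ℤ) (P : BiPath) : BiPath := ⟨shift z P.1, P.2.shift z⟩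

theorem measurable_translate (z : ℤ × ℤ) : Measurable (translate z) := by
  refine measurable_generateFrom ?_
  rintro _ ⟨u, v, rfl⟩
  exact MeasurableSpace.measurableSet_generateFrom ⟨u - z, v - z, rfl⟩

/-- A measure on the space of paths is translation invariant if all translations by vectors of
`ℤ²` preserve it. -/
def TranslationInvariant (μ : MeasureTheory.Measure BiPath) : Prop :=
  ∀ z : ℤ × ℤ, MeasureTheory.MeasurePreserving (translate z) μ μ

/-- `P` meets every integer translate of the four coordinate half-axes (those in the directions
`x₊`, `x₋`, `y₊`, `y₋`) infinitely many times. -/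
def MeetsAllRays (P : lattice.Subgraph) : Prop :=
  ∀ p d : ℤ × ℤ, d ∈ ({(1, 0), (-1, 0), (0, 1), (0, -1)} : Set (ℤ × ℤ)) →
    {q ∈ P.verts | ∃ s : ℕ, 0 < s ∧ q = p + (s : ℤ) • d}.Infinite

/-- The `n`-th closest to `p` (`n ≥ 1`) among the vertices of `P` on the open half-line from `p`
in the direction of the unit vector `d`. It is meaningful if there are at least `n` such vertices. -/
noncomputable def nthHit (P : lattice.Subgraph) (p d : ℤ × ℤ) (n : ℕ) : ℤ × ℤ :=
  p + (Nat.nth (fun s => 0 < s ∧ p + (s : ℤ) • d ∈ P.verts) (n - 1) : ℤ) • d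

/-- The lattice points of the `n`-th cross of `p`: the horizontal segment between the `n`-th hits in
the directions `x₋` and `x₊`, together with the vertical segment between the `n`-th hits in the
directions `y₋` and `y₊`. (Intervals are for the coordinatewise order on `ℤ²`; as the end points
share a coordinate, these are the lattice points of the segments.) -/
noncomputable def cross (P : lattice.Subgraph) (p : ℤ × ℤ) (n : ℕ) : Set (ℤ × ℤ) :=
  Set.Icc (nthHit P p (-1, 0) n) (nthHit P p (1, 0) n) ∪
    Set.Icc (nthHit P p (0, -1) n) (nthHit P p (0, 1) n)

/-- `S` is the `n`-th snail of `p`: the smallest connected subgraph of the path `P` that contains `p`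
and all the vertices of `P` on the `n`-th cross of `p`. -/
def IsSnail (P : lattice.Subgraph) (p : ℤ × ℤ) (n : ℕ) (S : lattice.Subgraph) : Prop :=
  IsLeast {T : lattice.Subgraph |
    T ≤ P ∧ T.Connected ∧ p ∈ T.verts ∧ P.verts ∩ cross P p n ⊆ T.verts} S

/-- The length of a snail: its number of edges. -/
noncomputable def length (S : lattice.Subgraph) : ℕ := S.edgeSet.ncard

end PlanarPath

open MeasureTheory Filter Set

namespace PlanarPath

/-! Poincaré recurrence, applied to a single translation, shows that almost surely every vertex `u`
has infinitely many `u + n • d` on the path. With a discrete intermediate value argument this gives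
`MeetsAllRays`.

For the quadratic bound, suppose that it fails at `p` for every `c`. Then for each `k` and all large
`n`, the first `n` hits to the right of `p` and above it lie within path distance `n² / k` of `p`
(`ShortHits`). Such vertices are sparse. In a row segment of length `M`, all of them are close along
the path to the leftmost one, and so are the first `M` hits above each of them. These hits are
distinct, and a piece of path of length about `4M² / k` has room for only about `4M / k` such
columns (`card_shortHits_mul_le`). Averaging over translates bounds the measure of `ShortHits k N`
at the origin by `5 / k` times the total mass, uniformly in `N` (`measure_shortHits_le`). Letting `N
→ ∞` and then `k → ∞` shows that failure is a null event. -/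

/-- `γ` enumerates the vertices of `P` in the order of the path. -/
structure IsParam (P : lattice.Subgraph) (γ : ℤ → ℤ × ℤ) : Prop where
  inj : Function.Injective γ
  mem_iff : ∀ u, u ∈ P.verts ↔ ∃ k, γ k = u
  adj_iff : ∀ i j, P.Adj (γ i) (γ j) ↔ |i - j| = 1

theorem IsBiInfinitePath.exists_isParam {P : lattice.Subgraph} (hP : IsBiInfinitePath P) :
    ∃ γ, IsParam P γ := by
  obtain ⟨t, ht⟩ := hP
  refine ⟨fun k => (t.symm k).1, fun i j h => t.symm.injective (Subtype.ext h), fun u => ?_,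
    fun i j => ?_⟩
  · constructor
    · intro hu
      exact ⟨t ⟨u, hu⟩, by simp⟩
    · rintro ⟨k, rfl⟩
      exact (t.symm k).2
  · simpa using ht (t.symm i) (t.symm j)

namespace IsParam

variable {P : lattice.Subgraph} {γ : ℤ → ℤ × ℤ}

theorem mem (h : IsParam P γ) (k : ℤ) : γ k ∈ P.verts := (h.mem_iff _).2 ⟨k, rfl⟩

theorem exists_adj (h : IsParam P γ) {u : ℤ × ℤ} (hu : u ∈ P.verts) : ∃ v, P.Adj u v := by
  obtain ⟨k, rfl⟩ := (h.mem_iff u).1 hu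
  exact ⟨γ (k + 1), (h.adj_iff _ _).2 (by simp)⟩

theorem lattice_adj_succ (h : IsParam P γ) (k : ℤ) :
    |(γ k).1 - (γ (k + 1)).1| + |(γ k).2 - (γ (k + 1)).2| = 1 :=
  P.adj_sub ((h.adj_iff k (k + 1)).2 (by simp))

end IsParam

/-- Discrete intermediate value theorem for integer sequences with steps of size at most one. -/
theorem exists_eq_of_abs_step_le_one {f : ℤ → ℤ} (hf : ∀ k, |f k - f (k + 1)| ≤ 1) {a b c : ℤ}
    (ha : f a ≤ c) (hb : c ≤ f b) : ∃ k, f k = c := by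
  by_contra! hne
  have hlt : ∀ k, f k < c := by
    intro k
    induction k using Int.inductionOn' (b := a) with
    | zero => exact lt_of_le_of_ne ha (hne a)
    | succ k _ ih =>
      have h1 := abs_le.1 (hf k)
      have h2 := hne (k + 1)
      omega
    | pred k _ ih =>
      have h1 := abs_le.1 (hf (k - 1))
      have h2 := hne (k - 1)
      rw [sub_add_cancel] at h1
      omega
  exact absurd (hlt b) (not_lt.2 hb)

/-! ### Measurability -/

theorem measurableSet_adj (u v : ℤ × ℤ) : MeasurableSet {P : BiPath | P.1.Adj u v} :=
  MeasurableSpace.measurableSet_generateFrom ⟨u, v, rfl⟩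

theorem measurableSet_mem_verts (u : ℤ × ℤ) : MeasurableSet {P : BiPath | u ∈ P.1.verts} := by
  have : {P : BiPath | u ∈ P.1.verts} = ⋃ v, {P : BiPath | P.1.Adj u v} := by
    ext P
    obtain ⟨γ, hγ⟩ := P.2.exists_isParam
    simp only [mem_ofPred_eq, mem_iUnion]
    exact ⟨fun hu => hγ.exists_adj hu, fun ⟨v, hv⟩ => P.1.edge_vert hv⟩
  rw [this]
  exact MeasurableSet.iUnion fun v => measurableSet_adj u v

/-- `v` can be reached from `u` by at most `m` steps along edges of `P`. -/
def Reach (P : lattice.Subgraph) : ℕ → ℤ × ℤ → ℤ × ℤ → Prop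
  | 0, u, v => u = v
  | m + 1, u, v => u = v ∨ ∃ w, P.Adj u w ∧ Reach P m w v

/-- `Reach` expresses path distance through edges alone, with no choice of enumeration, so the event
is built from edge events by countable unions. -/
theorem measurableSet_reach (m : ℕ) (u v : ℤ × ℤ) :
    MeasurableSet {P : BiPath | Reach P.1 m u v} := by
  induction m generalizing u with
  | zero => exact MeasurableSet.const _
  | succ m ih =>
    have : {P : BiPath | Reach P.1 (m + 1) u v} =
        {_P : BiPath | u = v} ∪
          ⋃ w, {P : BiPath | P.1.Adj u w} ∩ {P : BiPath | Reach P.1 m w v} := by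
      ext P
      simp [Reach]
    rw [this]
    exact (MeasurableSet.const _).union
      (MeasurableSet.iUnion fun w => (measurableSet_adj u w).inter (ih w))

theorem IsParam.reach_iff {P : lattice.Subgraph} {γ : ℤ → ℤ × ℤ} (h : IsParam P γ) (m : ℕ)
    (i j : ℤ) : Reach P m (γ i) (γ j) ↔ |i - j| ≤ m := by
  induction m generalizing i with
  | zero =>
    simp only [Reach, h.inj.eq_iff, Nat.cast_zero, abs_nonpos_iff, sub_eq_zero]
  | succ m ih =>
    simp only [Reach, h.inj.eq_iff]
    push_cast
    constructor
    · rintro (rfl | ⟨w, hw, hr⟩)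
      · simp; positivity
      · obtain ⟨l, rfl⟩ := (h.mem_iff w).1 (P.edge_vert (P.adj_symm hw))
        rw [h.adj_iff] at hw
        rw [ih] at hr
        have := abs_sub_le i l j
        omega
    · intro hij
      rcases lt_trichotomy i j with hlt | heq | hgt
      · right
        refine ⟨γ (i + 1), (h.adj_iff _ _).2 (by simp), (ih _).2 ?_⟩
        rw [abs_le] at hij ⊢
        omega
      · exact Or.inl heq
      · right
        refine ⟨γ (i - 1), (h.adj_iff _ _).2 (by simp), (ih _).2 ?_⟩
        rw [abs_le] at hij ⊢
        omega

theorem IsParam.shift {P : lattice.Subgraph} {γ : ℤ → ℤ × ℤ} (h : IsParam P γ) (z : ℤ × ℤ) :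
    IsParam (shift z P) (fun k => γ k + z) where
  inj i j hij := h.inj (add_right_cancel hij)
  mem_iff u := by
    change u - z ∈ P.verts ↔ _
    simp only [h.mem_iff, eq_sub_iff_add_eq]
  adj_iff i j := by
    change P.Adj (γ i + z - z) (γ j + z - z) ↔ _
    simp only [add_sub_cancel_right, h.adj_iff]

/-- The point at distance `s` from `p` is a vertex of `P` on the open half-line from `p` in direction
`d`. -/
def IsHit (P : lattice.Subgraph) (p d : ℤ × ℤ) (s : ℕ) : Prop :=
  0 < s ∧ p + (s : ℤ) • d ∈ P.verts

theorem isHit_shift (P : lattice.Subgraph) (p d z : ℤ × ℤ) :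
    IsHit (shift z P) p d = IsHit P (p - z) d := by
  funext s
  simp only [IsHit, shift, mem_ofPred_eq, eq_iff_iff]
  rw [show p + (s : ℤ) • d - z = p - z + (s : ℤ) • d by abel]

open Classical in
theorem measurable_count_isHit (p d : ℤ × ℤ) (s : ℕ) :
    Measurable fun P : BiPath => Nat.count (IsHit P.1 p d) s := by
  induction s with
  | zero => simp
  | succ s ih =>
    simp only [Nat.count_succ]
    refine ih.add (Measurable.ite ?_ measurable_const measurable_const)
    exact (MeasurableSet.const _).inter (measurableSet_mem_verts _)

/-- For every `n ≥ N`, the first `n` hits of the path from `p` in the directions `x₊` and `y₊` are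
within path distance `n² / k` of `p`. -/
def ShortHits (k N : ℕ) (P : lattice.Subgraph) (p : ℤ × ℤ) : Prop :=
  p ∈ P.verts ∧ ∀ n ≥ N, ∀ d : ℤ × ℤ, d = (1, 0) ∨ d = (0, 1) → ∀ s : ℕ, IsHit P p d s →
    (open Classical in Nat.count (IsHit P p d) s) < n → Reach P (n ^ 2 / k) p (p + (s : ℤ) • d)

theorem measurableSet_shortHits (k N : ℕ) (p : ℤ × ℤ) :
    MeasurableSet {P : BiPath | ShortHits k N P.1 p} := by
  classical
  have key : {P : BiPath | ShortHits k N P.1 p} = {P : BiPath | p ∈ P.1.verts} ∩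
      ⋂ n, ⋂ (_ : n ≥ N), ⋂ d : ℤ × ℤ, ⋂ (_ : d = (1, 0) ∨ d = (0, 1)), ⋂ s : ℕ,
        {P : BiPath | IsHit P.1 p d s → Nat.count (IsHit P.1 p d) s < n →
          Reach P.1 (n ^ 2 / k) p (p + (s : ℤ) • d)} := by
    ext P
    simp only [ShortHits, mem_ofPred_eq, mem_inter_iff, mem_iInter]
  rw [key]
  refine (measurableSet_mem_verts p).inter <| MeasurableSet.iInter fun n =>
    MeasurableSet.iInter fun _ => MeasurableSet.iInter fun d => MeasurableSet.iInter fun _ =>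
    MeasurableSet.iInter fun s => ?_
  have h1 : MeasurableSet {P : BiPath | IsHit P.1 p d s} :=
    (MeasurableSet.const _).inter (measurableSet_mem_verts _)
  have h2 : MeasurableSet {P : BiPath | Nat.count (IsHit P.1 p d) s < n} :=
    measurable_count_isHit p d s measurableSet_Iio
  exact h1.imp (h2.imp (measurableSet_reach _ _ _))

theorem reach_shift (P : lattice.Subgraph) (z : ℤ × ℤ) (m : ℕ) (u v : ℤ × ℤ) :
    Reach (shift z P) m u v ↔ Reach P m (u - z) (v - z) := by
  induction m generalizing u with
  | zero => simp [Reach]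
  | succ m ih =>
    simp only [Reach, ih, sub_left_inj]
    refine or_congr_right ⟨fun ⟨w, hw, hr⟩ => ⟨w - z, hw, hr⟩, fun ⟨w, hw, hr⟩ => ⟨w + z, ?_, ?_⟩⟩
    · change P.Adj (u - z) (w + z - z)
      rwa [add_sub_cancel_right]
    · rwa [add_sub_cancel_right]

theorem shortHits_shift (k N : ℕ) (P : lattice.Subgraph) (p z : ℤ × ℤ) :
    ShortHits k N (shift z P) p ↔ ShortHits k N P (p - z) := by
  refine and_congr Iff.rfl <| forall_congr' fun n => forall_congr' fun _ => forall_congr' fun d =>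
    forall_congr' fun _ => forall_congr' fun s => ?_
  rw [isHit_shift, reach_shift, add_sub_right_comm]

/-! ### Recurrence -/

theorem translate_neg_iterate_mem (d u : ℤ × ℤ) (n : ℕ) (P : BiPath) :
    u ∈ ((translate (-d))^[n] P).1.verts ↔ u + (n : ℤ) • d ∈ P.1.verts := by
  induction n generalizing P with
  | zero => simp
  | succ n ih =>
    rw [Function.iterate_succ_apply, ih]
    change u + (n : ℤ) • d - -d ∈ P.1.verts ↔ _
    rw [show u + (n : ℤ) • d - -d = u + ((n + 1 : ℕ) : ℤ) • d by push_cast; rw [add_smul]; abel_nf]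

/-- Poincaré recurrence for the translation by `-d`, which brings `u + d` to `u`. There are only
countably many pairs `u`, `d`. -/
theorem ae_frequently_mem {μ : Measure BiPath} [IsFiniteMeasure μ] (hμ : TranslationInvariant μ) :
    ∀ᵐ P : BiPath ∂μ, ∀ u d : ℤ × ℤ, u ∈ P.1.verts →
      ∃ᶠ n : ℕ in atTop, u + (n : ℤ) • d ∈ P.1.verts := by
  rw [ae_all_iff]; intro u
  rw [ae_all_iff]; intro d
  filter_upwards [(hμ (-d)).conservative.ae_mem_imp_frequently_image_mem
    (measurableSet_mem_verts u).nullMeasurableSet] with P hP hu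
  exact (hP hu).mono fun n hn => (translate_neg_iterate_mem d u n P).1 hn

/-- Recurrence only concerns lines that already contain a vertex. But it makes both coordinates
unbounded in both directions along the path, and they change by at most one per step, so every
horizontal and vertical line contains a vertex. -/
theorem MeetsAllRays.of_frequently {P : lattice.Subgraph} (hP : IsBiInfinitePath P)
    (h : ∀ u d : ℤ × ℤ, u ∈ P.verts → ∃ᶠ n : ℕ in atTop, u + (n : ℤ) • d ∈ P.verts) :
    MeetsAllRays P := by
  obtain ⟨γ, hγ⟩ := hP.exists_isParam
  have key : ∀ g : ℤ × ℤ → ℤ, (∀ k, |g (γ k) - g (γ (k + 1))| ≤ 1) → ∀ e : ℤ × ℤ,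
      (∀ (u : ℤ × ℤ) (n : ℤ), g (u + n • e) = g u + n) → ∀ c, ∃ v ∈ P.verts, g v = c := by
    intro g hg e he c
    have hlow : ∃ a, g (γ a) ≤ c := by
      obtain ⟨n, hn, hmem⟩ := ((h (γ 0) (-e) (hγ.mem 0)).and_eventually
        (eventually_ge_atTop (g (γ 0) - c).toNat)).exists.imp fun n hn => hn.symm
      obtain ⟨a, ha⟩ := (hγ.mem_iff _).1 hmem
      refine ⟨a, ?_⟩
      rw [ha, smul_neg, ← neg_smul, he]
      omega
    have hhigh : ∃ b, c ≤ g (γ b) := by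
      obtain ⟨n, hn, hmem⟩ := ((h (γ 0) e (hγ.mem 0)).and_eventually
        (eventually_ge_atTop (c - g (γ 0)).toNat)).exists.imp fun n hn => hn.symm
      obtain ⟨a, ha⟩ := (hγ.mem_iff _).1 hmem
      refine ⟨a, ?_⟩
      rw [ha, he]
      omega
    obtain ⟨a, ha⟩ := hlow
    obtain ⟨b, hb⟩ := hhigh
    obtain ⟨k, hk⟩ := exists_eq_of_abs_step_le_one (f := fun k => g (γ k)) hg ha hb
    exact ⟨γ k, hγ.mem k, hk⟩
  intro p d hd
  have hline : d ≠ 0 ∧ ∃ r : ℤ, p + r • d ∈ P.verts := by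
    have hx : ∃ v ∈ P.verts, v.1 = p.1 := key Prod.fst (fun k => by
      have := hγ.lattice_adj_succ k
      have := abs_nonneg ((γ k).2 - (γ (k + 1)).2)
      omega) (1, 0) (by simp) p.1
    have hy : ∃ v ∈ P.verts, v.2 = p.2 := key Prod.snd (fun k => by
      have := hγ.lattice_adj_succ k
      have := abs_nonneg ((γ k).1 - (γ (k + 1)).1)
      omega) (0, 1) (by simp) p.2
    obtain ⟨v, hv, hvx⟩ := hx
    obtain ⟨w, hw, hwy⟩ := hy
    have e1 : p + (v.2 - p.2) • ((0, 1) : ℤ × ℤ) = v := by ext <;> simp [hvx]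
    have e2 : p + (p.2 - v.2) • ((0, -1) : ℤ × ℤ) = v := by ext <;> simp [hvx]
    have e3 : p + (w.1 - p.1) • ((1, 0) : ℤ × ℤ) = w := by ext <;> simp [hwy]
    have e4 : p + (p.1 - w.1) • ((-1, 0) : ℤ × ℤ) = w := by ext <;> simp [hwy]
    simp only [mem_insert_iff, mem_singleton_iff] at hd
    rcases hd with rfl | rfl | rfl | rfl
    · exact ⟨by simp, _, e3 ▸ hw⟩
    · exact ⟨by simp, _, e4 ▸ hw⟩
    · exact ⟨by simp, _, e1 ▸ hv⟩
    · exact ⟨by simp, _, e2 ▸ hv⟩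
  obtain ⟨hd0, r, hr⟩ := hline
  have hfreq : ∃ᶠ s : ℕ in atTop, 0 < s ∧ p + (s : ℤ) • d ∈ P.verts := by
    rw [frequently_atTop]
    intro N
    -- The known vertex may lie behind `p` (`r < 0`); the bound on `n` puts `r + n` beyond `N`.
    obtain ⟨n, hmem, hn⟩ := ((h _ d hr).and_eventually
      (eventually_ge_atTop ((N : ℤ) + 1 - r).toNat)).exists
    refine ⟨(r + n).toNat, by omega, by omega, ?_⟩
    rw [Int.toNat_of_nonneg (by omega), add_smul, ← add_assoc]
    exact hmem
  have hinj : Function.Injective fun s : ℕ => p + (s : ℤ) • d := fun a b hab => by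
    have := smul_left_injective ℤ hd0 (add_left_cancel hab)
    exact_mod_cast this
  refine ((Nat.frequently_atTop_iff_infinite.1 hfreq).image hinj.injOn).mono ?_
  rintro _ ⟨s, ⟨hs, hmem⟩, rfl⟩
  exact ⟨hmem, s, hs, rfl⟩

theorem MeetsAllRays.infinite_isHit {P : lattice.Subgraph} (h : MeetsAllRays P) (p : ℤ × ℤ)
    {d : ℤ × ℤ} (hd : d ∈ ({(1, 0), (-1, 0), (0, 1), (0, -1)} : Set (ℤ × ℤ))) :
    {s | IsHit P p d s}.Infinite := by
  intro hfin
  refine h p d hd ((hfin.image fun s : ℕ => p + (s : ℤ) • d).subset ?_)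
  rintro q ⟨hq, s, hs, rfl⟩
  exact ⟨s, ⟨hs, hq⟩, rfl⟩

/-! ### Snails -/

/-- The part of an enumerated path between the times `a` and `b`. -/
def IsParam.segment {P : lattice.Subgraph} {γ : ℤ → ℤ × ℤ} (h : IsParam P γ) (a b : ℤ) :
    lattice.Subgraph where
  verts := γ '' Icc a b
  Adj u v := ∃ i ∈ Icc a b, ∃ j ∈ Icc a b, |i - j| = 1 ∧ γ i = u ∧ γ j = v
  adj_sub := by
    rintro _ _ ⟨i, -, j, -, hij, rfl, rfl⟩
    exact P.adj_sub ((h.adj_iff i j).2 hij)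
  edge_vert := by
    rintro _ _ ⟨i, hi, j, -, -, rfl, rfl⟩
    exact ⟨i, hi, rfl⟩
  symm := ⟨by
    rintro _ _ ⟨i, hi, j, hj, hij, rfl, rfl⟩
    exact ⟨j, hj, i, hi, by rwa [abs_sub_comm], rfl, rfl⟩⟩

namespace IsParam

variable {P : lattice.Subgraph} {γ : ℤ → ℤ × ℤ} (h : IsParam P γ)

include h in
-- If the edge from `γ k` to `γ (k + 1)` is missing, a walk in `T` starting at an index at most `k`
-- can never pass `k`.
theorem adj_of_connected {T : lattice.Subgraph} (hT : T ≤ P) (hc : T.Connected) {a b k : ℤ}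
    (ha : γ a ∈ T.verts) (hb : γ b ∈ T.verts) (hak : a ≤ k) (hkb : k < b) :
    T.Adj (γ k) (γ (k + 1)) := by
  by_contra hk
  have hwalk : ∀ {u v : T.verts} (_ : T.coe.Walk u v), (∃ i ≤ k, γ i = u) → ∃ i ≤ k, γ i = v := by
    intro u v w
    induction w with
    | nil => exact id
    | @cons u v w huv _ ih =>
      rintro ⟨i, hi, hiu⟩
      refine ih ?_
      have huv' : T.Adj u v := huv
      obtain ⟨j, hj⟩ := (h.mem_iff v).1 (hT.1 v.2)
      have hadj := hT.2 huv'
      rw [← hiu, ← hj, h.adj_iff] at hadj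
      refine ⟨j, ?_, hj⟩
      by_contra hjk
      have hi' : i = k := by have := abs_le.1 hadj.le; omega
      have hj' : j = k + 1 := by have := abs_le.1 hadj.le; omega
      rw [← hiu, ← hj, hi', hj'] at huv'
      exact hk huv'
  obtain ⟨w⟩ := hc.coe.preconnected ⟨γ a, ha⟩ ⟨γ b, hb⟩
  obtain ⟨i, hi, hib⟩ := hwalk w ⟨a, hak, rfl⟩
  have := h.inj hib
  omega

theorem segment_le {T : lattice.Subgraph} (hT : T ≤ P) (hc : T.Connected) {a b : ℤ}
    (ha : γ a ∈ T.verts) (hb : γ b ∈ T.verts) : h.segment a b ≤ T := by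
  refine ⟨?_, ?_⟩
  · rintro _ ⟨k, ⟨hak, hkb⟩, rfl⟩
    rcases hkb.eq_or_lt with rfl | hlt
    · exact hb
    · exact T.edge_vert (h.adj_of_connected hT hc ha hb hak hlt)
  · rintro _ _ ⟨i, ⟨hai, hib⟩, j, ⟨haj, hjb⟩, hij, rfl, rfl⟩
    rcases (abs_eq zero_le_one).1 hij with h1 | h1
    · obtain rfl : i = j + 1 := by omega
      exact (h.adj_of_connected hT hc ha hb haj (by omega)).symm
    · obtain rfl : j = i + 1 := by omega
      exact h.adj_of_connected hT hc ha hb hai (by omega)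

theorem segment_le_self (a b : ℤ) : h.segment a b ≤ P := by
  refine ⟨?_, ?_⟩
  · rintro _ ⟨k, -, rfl⟩
    exact h.mem k
  · rintro _ _ ⟨i, -, j, -, hij, rfl, rfl⟩
    exact (h.adj_iff i j).2 hij

theorem segment_connected {a b : ℤ} (hab : a ≤ b) : (h.segment a b).Connected := by
  have hmem : ∀ k (hk : k ∈ Icc a b), γ k ∈ (h.segment a b).verts := fun k hk => ⟨k, hk, rfl⟩
  have hreach : ∀ n : ℕ, ∀ hn : a + n ∈ Icc a b, (h.segment a b).coe.Reachable
      ⟨γ a, hmem a ⟨le_rfl, hab⟩⟩ ⟨γ (a + n), hmem _ hn⟩ := by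
    intro n
    induction n with
    | zero =>
      intro hn
      simp
    | succ n ih =>
      intro hn
      have hn' : a + (n : ℤ) ∈ Icc a b := by
        have := hn.2
        push_cast at this
        exact ⟨by omega, by omega⟩
      refine (ih hn').trans (SimpleGraph.Adj.reachable ?_)
      exact ⟨_, hn', _, hn, by simp, rfl, rfl⟩
  refine ⟨(SimpleGraph.connected_iff_exists_forall_reachable _).2
    ⟨⟨γ a, hmem a ⟨le_rfl, hab⟩⟩, ?_⟩⟩
  rintro ⟨_, k, hk, rfl⟩
  have hk' : a + ((k - a).toNat : ℤ) = k := by have := hk.1; omega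
  have := hreach (k - a).toNat (by rwa [hk'])
  simpa only [hk'] using this

theorem sub_le_length_segment (a b : ℤ) : b - a ≤ length (h.segment a b) := by
  -- Finiteness is needed because `ncard` is `0` on infinite sets.
  have hfin : (h.segment a b).edgeSet.Finite := by
    refine (((finite_Icc a b).prod (finite_Icc a b)).image
      fun q : ℤ × ℤ => s(γ q.1, γ q.2)).subset ?_
    intro e he
    induction e with
    | _ u v =>
      obtain ⟨i, hi, j, hj, -, rfl, rfl⟩ := he
      exact ⟨(i, j), ⟨hi, hj⟩, rfl⟩
  have hinj : Function.Injective fun k : ℤ => s(γ k, γ (k + 1)) := by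
    intro k l hkl
    simp only [Sym2.eq_iff, h.inj.eq_iff] at hkl
    omega
  have hsub : (fun k : ℤ => s(γ k, γ (k + 1))) '' Ico a b ⊆ (h.segment a b).edgeSet := by
    rintro _ ⟨k, ⟨hak, hkb⟩, rfl⟩
    exact ⟨k, ⟨hak, hkb.le⟩, k + 1, ⟨by omega, by omega⟩, by simp, rfl, rfl⟩
  have := ncard_le_ncard hsub hfin
  rw [ncard_image_of_injective _ hinj, ← Finset.coe_Ico, ncard_coe_finset, Int.card_Ico] at this
  unfold length
  omega

include h in
-- The cross is finite, so the times of its path vertices, together with `i`, have a minimum and a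
-- maximum. The snail is the path segment between them, and its length bounds the time from `i` to
-- any of these vertices.
theorem exists_isSnail (i n) : ∃ S, IsSnail P (γ i) n S ∧
    ∀ j, γ j ∈ cross P (γ i) n → |i - j| ≤ length S := by
  let J : Set ℤ := insert i (γ ⁻¹' cross P (γ i) n)
  have hJ : J.Finite := Finite.insert _ <|
    ((finite_Icc _ _).union (finite_Icc _ _)).preimage h.inj.injOn
  obtain ⟨a, haJ, ha⟩ := exists_min_image J id hJ ⟨i, mem_insert _ _⟩
  obtain ⟨b, hbJ, hb⟩ := exists_max_image J id hJ ⟨i, mem_insert _ _⟩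
  have hi : i ∈ Icc a b := ⟨ha i (mem_insert _ _), hb i (mem_insert _ _)⟩
  have hj : ∀ j, γ j ∈ cross P (γ i) n → j ∈ Icc a b := fun j hj =>
    ⟨ha j (mem_insert_of_mem _ hj), hb j (mem_insert_of_mem _ hj)⟩
  refine ⟨h.segment a b, ⟨⟨h.segment_le_self a b, h.segment_connected (hi.1.trans hi.2),
    ⟨i, hi, rfl⟩, ?_⟩, ?_⟩, ?_⟩
  · rintro u ⟨hu, huc⟩
    obtain ⟨j, rfl⟩ := (h.mem_iff u).1 hu
    exact ⟨j, hj j huc, rfl⟩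
  · rintro T ⟨hTP, hTc, hTi, hT⟩
    have hmem : ∀ j ∈ J, γ j ∈ T.verts := by
      rintro j (rfl | hj)
      · exact hTi
      · exact hT ⟨h.mem j, hj⟩
    exact h.segment_le hTP hTc (hmem a haJ) (hmem b hbJ)
  · intro j hjc
    have h1 := hj j hjc
    have h2 := h.sub_le_length_segment a b
    rw [abs_le]
    simp only [mem_Icc] at h1 hi
    omega

end IsParam

open Classical in
theorem MeetsAllRays.mem_cross {P : lattice.Subgraph} (h : MeetsAllRays P) {p d : ℤ × ℤ}
    (hd : d = (1, 0) ∨ d = (0, 1)) {n s : ℕ} (hs : IsHit P p d s)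
    (hn : Nat.count (IsHit P p d) s < n) : p + (s : ℤ) • d ∈ cross P p n := by
  have hle : s ≤ Nat.nth (IsHit P p d) (n - 1) := by
    -- `Nat.nth` is monotone only because there are infinitely many hits; past the end of a finite
    -- set it would be `0`.
    have hinf := h.infinite_isHit p (d := d) (by rcases hd with rfl | rfl <;> simp)
    calc s = Nat.nth (IsHit P p d) (Nat.count (IsHit P p d) s) := (Nat.nth_count hs).symm
      _ ≤ _ := Nat.nth_monotone hinf (by omega)
  have hle' : (s : ℤ) ≤ Nat.nth (IsHit P p d) (n - 1) := by exact_mod_cast hle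
  rcases hd with rfl | rfl
  · exact Or.inl ⟨by constructor <;> simp [nthHit],
      add_le_add_right (zsmul_le_zsmul_left (by decide) hle') p⟩
  · exact Or.inr ⟨by constructor <;> simp [nthHit],
      add_le_add_right (zsmul_le_zsmul_left (by decide) hle') p⟩

/-- If the snails of a vertex do not have length at least `c n²` for infinitely many `n`, for any
`c > 0`, then its hits are short. -/
theorem MeetsAllRays.exists_shortHits {P : lattice.Subgraph} (hP : IsBiInfinitePath P)
    (h : MeetsAllRays P) {p : ℤ × ℤ} (hp : p ∈ P.verts)
    (hfail : ¬ ∃ c : ℝ, 0 < c ∧ {n : ℕ | 1 ≤ n ∧ ∃ S : lattice.Subgraph,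
      IsSnail P p n S ∧ c * (n : ℝ) ^ 2 ≤ (length S : ℝ)}.Infinite) (k : ℕ) (hk : 0 < k) :
    ∃ N, ShortHits k N P p := by
  obtain ⟨γ, hγ⟩ := hP.exists_isParam
  obtain ⟨i, rfl⟩ := (hγ.mem_iff p).1 hp
  have hk' : (0 : ℝ) < k := by exact_mod_cast hk
  push Not at hfail
  -- Failure for `c = 1 / k`: beyond `N`, every snail is shorter than `n² / k`.
  obtain ⟨N, hN⟩ := (hfail (1 / k) (by positivity)).bddAbove
  refine ⟨N + 1, hp, fun n hn d hd s hs hc => ?_⟩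
  have hns : ¬ _ := fun hmem => absurd (hN hmem) (by omega : ¬ n ≤ N)
  obtain ⟨S, hS, hlen⟩ := hγ.exists_isSnail i n
  obtain ⟨j, hj⟩ := (hγ.mem_iff _).1 hs.2
  rw [← hj, hγ.reach_iff]
  refine (hlen j (hj ▸ h.mem_cross hd hs hc)).trans ?_
  norm_cast
  rw [Nat.le_div_iff_mul_le hk]
  by_contra hlt
  refine hns ⟨by omega, S, hS, ?_⟩
  rw [one_div, inv_mul_le_iff₀ hk', mul_comm]
  exact_mod_cast (not_le.1 hlt).le

/-! ### Counting -/

open Classical in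
/-- A row segment of length `M` carries few vertices all of whose hits are short: the first `M` hits
above them are distinct vertices in a short piece of the path. -/
theorem card_shortHits_mul_le {P : lattice.Subgraph} (hP : IsBiInfinitePath P)
    (h : MeetsAllRays P) {k N M : ℕ} (hM : N ≤ M) :
    ((Finset.range M).filter fun i : ℕ => ShortHits k N P (i, 0)).card * M ≤
      4 * (M ^ 2 / k) + 1 := by
  obtain ⟨γ, hγ⟩ := hP.exists_isParam
  set I := (Finset.range M).filter fun i : ℕ => ShortHits k N P (i, 0) with hI
  rcases I.eq_empty_or_nonempty with hemp | hne
  · simp [hemp]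
  set m := M ^ 2 / k
  have hI' : ∀ i ∈ I, i < M ∧ ShortHits k N P (i, 0) := fun i hi => by simpa [hI] using hi
  -- Every other element of `I` is a hit to the right of the leftmost one, of rank less than `M`.
  have hmin := hI' _ (I.min'_mem hne)
  set i₀ := I.min' hne
  obtain ⟨t₀, ht₀⟩ := (hγ.mem_iff _).1 hmin.2.1
  have hrow : ∀ i ∈ I, ∃ t, γ t = ((i : ℤ), (0 : ℤ)) ∧ |t₀ - t| ≤ m := by
    intro i hi
    obtain ⟨t, ht⟩ := (hγ.mem_iff _).1 (hI' i hi).2.1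
    refine ⟨t, ht, ?_⟩
    rw [← hγ.reach_iff, ht, ht₀]
    rcases (I.min'_le i hi).eq_or_lt with heq | hlt
    · rw [← heq, ← ht₀, hγ.reach_iff]
      simp
    · have heq : (((i₀ : ℕ) : ℤ), (0 : ℤ)) + ((i - i₀ : ℕ) : ℤ) • ((1, 0) : ℤ × ℤ) =
          ((i : ℤ), (0 : ℤ)) := by
        ext
        · simp only [Prod.fst_add, Prod.smul_fst, smul_eq_mul, mul_one]
          have : i₀ < i := hlt
          omega
        · simp
      rw [← heq]
      refine hmin.2.2 M hM (1, 0) (Or.inl rfl) (i - i₀) ⟨Nat.sub_pos_of_lt hlt, ?_⟩ ?_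
      · rw [heq]
        exact (hI' i hi).2.1
      · exact (Nat.count_le _).trans_lt (by have := (hI' i hi).1; omega)
  -- Triangle inequality: at most `m` along the row, then at most `m` up the column.
  have hcol : ∀ i ∈ I, ∀ j < M, ∃ t,
      γ t = ((i : ℤ), (0 : ℤ)) + (Nat.nth (IsHit P (i, 0) (0, 1)) j : ℤ) • ((0, 1) : ℤ × ℤ) ∧
        |t₀ - t| ≤ 2 * m := by
    intro i hi j hj
    have hinf := h.infinite_isHit ((i : ℤ), (0 : ℤ)) (d := (0, 1)) (by simp)
    have hhit := Nat.nth_mem_of_infinite hinf j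
    obtain ⟨t, ht⟩ := (hγ.mem_iff _).1 hhit.2
    obtain ⟨t', ht', hle⟩ := hrow i hi
    refine ⟨t, ht, ?_⟩
    have hr := (hI' i hi).2.2 M hM (0, 1) (Or.inr rfl) _ hhit
      (by rw [Nat.count_nth_of_infinite hinf]; exact hj)
    rw [← ht, ← ht', hγ.reach_iff] at hr
    have := abs_sub_le t₀ t' t
    change |t' - t| ≤ (m : ℤ) at hr
    omega
  choose! T hT hTle using hcol
  -- The `|I| * M` times are distinct: different `i` give different columns, and `Nat.nth` is
  -- injective within a column. They lie in an interval of `4 * m + 1` integers.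
  have hcard := Finset.card_le_card_of_injOn (s := I ×ˢ Finset.range M)
    (t := Finset.Icc (t₀ - 2 * m) (t₀ + 2 * m)) (fun q => T q.1 q.2) (by
      rintro ⟨i, j⟩ hq
      simp only [Finset.coe_product, mem_prod, Finset.mem_coe, Finset.mem_range] at hq
      have := abs_le.1 (hTle i hq.1 j hq.2)
      simp only [Finset.coe_Icc, mem_Icc]
      omega) (by
      rintro ⟨i, j⟩ hq ⟨i', j'⟩ hq' heq
      simp only [Finset.coe_product, mem_prod, Finset.mem_coe, Finset.mem_range] at hq hq' heq
      have h1 := hT i hq.1 j hq.2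
      rw [heq, hT i' hq'.1 j' hq'.2] at h1
      simp only [Prod.smul_mk, smul_eq_mul, mul_zero, mul_one, Prod.mk_add_mk, add_zero, zero_add,
        Prod.mk.injEq, Nat.cast_inj] at h1
      obtain ⟨rfl, h2⟩ := h1
      have hinf := h.infinite_isHit ((i' : ℤ), (0 : ℤ)) (d := (0, 1)) (by simp)
      rw [Nat.nth_injective hinf h2])
  rw [Finset.card_product, Finset.card_range, Int.card_Icc] at hcard
  omega

/-- By invariance, the expected number of short-hit vertices in a row segment of length `M` is `M`
times the measure at the origin. The bound is independent of `N` because `M` may be taken as large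
as needed. -/
theorem measure_shortHits_le {μ : Measure BiPath} [IsFiniteMeasure μ]
    (hμ : TranslationInvariant μ) (k N : ℕ) (hk : 0 < k) :
    μ {P : BiPath | ShortHits k N P.1 0} ≤ ENNReal.ofReal (5 / k * μ.real univ) := by
  classical
  set G := {P : BiPath | ShortHits k N P.1 0} with hG
  have hGm : MeasurableSet G := measurableSet_shortHits k N 0
  -- `M ≥ N` is needed for the counting, and `M² ≥ k` lets the additive `1` be absorbed, turning `4`
  -- into `5`.
  set M := N + k + 1 with hM
  have hmem : ∀ (P : BiPath) (i : ℕ),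
      translate (-((i : ℤ), (0 : ℤ))) P ∈ G ↔ ShortHits k N P.1 (i, 0) := fun P i => by
    change ShortHits k N (shift _ P.1) 0 ↔ _
    rw [shortHits_shift, zero_sub, neg_neg]
  have hint : ∀ i ∈ Finset.range M, Integrable
      (fun P => G.indicator (1 : BiPath → ℝ) (translate (-((i : ℤ), (0 : ℤ))) P)) μ := fun i _ =>
    (hμ _).integrable_comp_of_integrable ((integrable_const 1).indicator hGm)
  have hsum : ∫ P, ∑ i ∈ Finset.range M,
      G.indicator (1 : BiPath → ℝ) (translate (-((i : ℤ), (0 : ℤ))) P) ∂μ = M * μ.real G := by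
    rw [integral_finsetSum _ hint]
    have : ∀ i ∈ Finset.range M, ∫ P, G.indicator (1 : BiPath → ℝ)
        (translate (-((i : ℤ), (0 : ℤ))) P) ∂μ = μ.real G := fun i _ => by
      have hmap := integral_map (μ := μ)
        (hμ (-((i : ℤ), (0 : ℤ)))).measurable.aemeasurable
        (((measurable_one (α := ℝ)).indicator hGm).aestronglyMeasurable)
      rw [← hmap, (hμ _).map_eq]
      exact integral_indicator_one hGm
    rw [Finset.sum_congr rfl this]
    simp
  have hMpos : (0 : ℝ) < M := by positivity
  have hkpos : (0 : ℝ) < k := by exact_mod_cast hk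
  have hbound : ∀ᵐ P ∂μ, ∑ i ∈ Finset.range M,
      G.indicator (1 : BiPath → ℝ) (translate (-((i : ℤ), (0 : ℤ))) P) ≤ 5 / k * M := by
    filter_upwards [ae_frequently_mem hμ] with P hP
    have hcount := card_shortHits_mul_le P.2 (MeetsAllRays.of_frequently P.2 hP)
      (k := k) (N := N) (M := M) (by omega)
    have heq : ∑ i ∈ Finset.range M,
        G.indicator (1 : BiPath → ℝ) (translate (-((i : ℤ), (0 : ℤ))) P) =
        ((Finset.range M).filter fun i : ℕ => ShortHits k N P.1 (i, 0)).card := by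
      simp only [indicator_apply, hmem, Pi.one_apply, Finset.sum_boole]
    rw [heq]
    have h1 : (((Finset.range M).filter fun i : ℕ => ShortHits k N P.1 (i, 0)).card : ℝ) * M ≤
        4 * ((M : ℝ) ^ 2 / k) + 1 := by
      have h2 : ((M ^ 2 / k : ℕ) : ℝ) ≤ (M : ℝ) ^ 2 / k := by
        exact_mod_cast Nat.cast_div_le (α := ℝ) (m := M ^ 2) (n := k)
      have h3 : (((Finset.range M).filter fun i : ℕ => ShortHits k N P.1 (i, 0)).card : ℝ) * M ≤
        4 * ((M ^ 2 / k : ℕ) : ℝ) + 1 := by exact_mod_cast hcount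
      linarith
    have h4 : (1 : ℝ) ≤ (M : ℝ) ^ 2 / k := by
      rw [le_div_iff₀ hkpos, one_mul]
      have : k ≤ M ^ 2 := by nlinarith [Nat.zero_le N]
      exact_mod_cast this
    refine le_of_mul_le_mul_right ?_ hMpos
    calc _ ≤ 5 * ((M : ℝ) ^ 2 / k) := by linarith
      _ = _ := by ring
  have hle := integral_mono_ae (integrable_finsetSum _ hint) (integrable_const _) hbound
  rw [hsum, integral_const, smul_eq_mul] at hle
  have : μ.real G ≤ 5 / k * μ.real univ := by
    refine le_of_mul_le_mul_left ?_ hMpos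
    linarith
  exact (ENNReal.le_ofReal_iff_toReal_le (measure_ne_top _ _) (by positivity)).2 this

/-! ### Almost sure failure of short hits -/

theorem ShortHits.mono {k N N' : ℕ} (hN : N ≤ N') {P : lattice.Subgraph} {p : ℤ × ℤ}
    (h : ShortHits k N P p) : ShortHits k N' P p :=
  ⟨h.1, fun n hn => h.2 n (hN.trans hn)⟩

/-- At the origin, the events increase with `N`, so their union obeys the same bound `5 / k`, which
tends to `0`. Invariance carries this to any `p`. -/
theorem ae_not_forall_exists_shortHits {μ : Measure BiPath} [IsFiniteMeasure μ]
    (hμ : TranslationInvariant μ) (p : ℤ × ℤ) :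
    ∀ᵐ P : BiPath ∂μ, ¬ ∀ k : ℕ, 0 < k → ∃ N, ShortHits k N P.1 p := by
  have hzero : ∀ᵐ P : BiPath ∂μ, ¬ ∀ k : ℕ, 0 < k → ∃ N, ShortHits k N P.1 0 := by
    rw [ae_iff]
    simp only [not_not]
    have hle : ∀ k : ℕ, μ {P : BiPath | ∀ k : ℕ, 0 < k → ∃ N, ShortHits k N P.1 0} ≤
        ENNReal.ofReal (5 / (k + 1 : ℕ) * μ.real univ) := fun k => by
      calc _ ≤ μ (⋃ N, {P : BiPath | ShortHits (k + 1) N P.1 0}) :=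
            measure_mono fun P (hP : ∀ k : ℕ, 0 < k → ∃ N, ShortHits k N P.1 0) =>
              mem_iUnion.2 (hP (k + 1) k.succ_pos)
        _ = ⨆ N, μ {P : BiPath | ShortHits (k + 1) N P.1 0} :=
            Monotone.measure_iUnion fun _ _ hN _ hP => ShortHits.mono hN hP
        _ ≤ _ := iSup_le fun N => measure_shortHits_le hμ (k + 1) N k.succ_pos
    have hlim : Tendsto (fun k : ℕ => ENNReal.ofReal (5 / (k + 1 : ℕ) * μ.real univ)) atTop
        (nhds 0) := by
      rw [← ENNReal.ofReal_zero]
      refine ENNReal.tendsto_ofReal ?_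
      rw [← zero_mul (μ.real univ)]
      exact ((tendsto_const_div_atTop_nhds_zero_nat (5 : ℝ)).comp
        (tendsto_add_atTop_nat 1)).mul_const _
    exact le_antisymm (ge_of_tendsto' hlim hle) zero_le
  filter_upwards [(hμ (-p)).quasiMeasurePreserving.ae hzero] with P hP hshort
  refine hP fun k hk => (hshort k hk).imp fun N hN => ?_
  change ShortHits k N (shift (-p) P.1) 0
  rwa [shortHits_shift, zero_sub, neg_neg]

end PlanarPath

theorem mainTheorem3 (μ : MeasureTheory.Measure PlanarPath.BiPath)
    [MeasureTheory.IsFiniteMeasure μ] (hμ : PlanarPath.TranslationInvariant μ) :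
    ∀ᵐ P : PlanarPath.BiPath ∂μ,
      PlanarPath.MeetsAllRays P.1 ∧
      ∀ p ∈ P.1.verts, ∃ c : ℝ, 0 < c ∧
        {n : ℕ | 1 ≤ n ∧ ∃ S : PlanarPath.lattice.Subgraph,
          PlanarPath.IsSnail P.1 p n S ∧
            c * (n : ℝ) ^ 2 ≤ (PlanarPath.length S : ℝ)}.Infinite := by
  -- The lattice is countable, so one null set serves all vertices `p`.
  filter_upwards [PlanarPath.ae_frequently_mem hμ,
    MeasureTheory.ae_all_iff.2 (PlanarPath.ae_not_forall_exists_shortHits hμ)] with P hP hshort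
  have hrays := PlanarPath.MeetsAllRays.of_frequently P.2 hP
  refine ⟨hrays, fun p hp => ?_⟩
  by_contra hfail
  exact hshort p fun k hk => hrays.exists_shortHits P.2 hp hfail k hk
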